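/- Let $(\mathcal V,\otimes,I,\tau)$ be a braided closed monoidal category (each functor $X\otimes-$ has a right adjoint $[X,-]$) with equalisers, written as if it were strict, and let $\mathcal A=(A,m,e)$ be an algebra (monoid) in $\mathcal V$. Let $\eta^A_V:V\to[A,A\otimes V]$ be the unit of the adjunction $A\otimes-\dashv[A,-]$. Let $\mathcal A^\tau=(A,m^\tau,e)$ with $m^\tau=m\cdot\tau_{A,A}$ be the opposite algebra, and let $\mathcal A^e=\mathcal A\otimes\mathcal A^\tau$ be the braided tensor product algebra, with multiplication $(m\otimes m^\tau)\cdot(A\otimes\tau_{A,A}\otimes A)$ and unit $e\otimes e$. The natural transformation $\tau_{A,A}\otimes-$ is a distributive law of the monad $\mathcal A^\tau\otimes-$ over the monad $\mathcal A\otimes-$, and satisfies the Yang–Baxter equation; the resulting composite monad, with functor part $A\otimes A\otimes-$, is the monad $\mathcal A^e\otimes-$, so that its Eilenberg–Moore category is the category ${}_{\mathcal A^e}\mathcal V$ of left $\mathcal A^e$-modules. The algebra $\mathcal A$ is called *left Azumaya* if the monad $\mathcal A\otimes-$ is Azumaya with respect to $\tau_{A,A}\otimes-$, that is, if the comparison functor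 $$\overline K_l:\mathcal V\to{}_{\mathcal A^e}\mathcal V,\qquad V\mapsto\bigl(A\otimes V,\ A\otimes A\otimes A\otimes V\xrightarrow{A\otimes m^\tau\otimes V}A\otimes A\otimes V\xrightarrow{m\otimes V}A\otimes V\bigr)$$ is an equivalence of categories. A morphism $f$ in $\mathcal V$ is called a *pure monomorphism* if $f\otimes X$ is a regular monomorphism for every $X\in\mathcal V$. For a left $\mathcal A^e$-module $(V,h)$, with $h:A\otimes A\otimes V\to V$, the object of invariants $i_V:{}^{\mathcal A}V\to V$ is the equaliser of the two morphisms $$[A,h]\cdot[A,e\otimes A\otimes V]\cdot\eta^A_V,\qquad [A,h]\cdot[A,A\otimes e\otimes V]\cdot\eta^A_V\ :\ V\to[A,V].$$ **Theorem.** $\mathcal A$ is left Azumaya if and only if 1. the morphism $e:I\to A$ is a pure monomorphism, and 2. for every left $\mathcal A^e$-module $(V,h)$, the composite $$A\otimes{}^{\mathcal A}V\xrightarrow{A\otimes i_V}A\otimes V\xrightarrow{A\otimes e\otimes V}A\otimes A\otimes V\xrightarrow{h}V$$ is an isomorphism. -/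

import Mathlib

open CategoryTheory MonoidalCategory Limits

universe v u

namespace AzumayaTheory

section Monads

variable {C : Type u} [Category.{v} C]

/-- A distributive law `T S ⟶ S T` of a monad `T` over a monad `S`
(the component at `X` is a morphism `T (S X) ⟶ S (T X)`). -/
structure DistributiveLaw (T S : Monad C) where
  law : S.toFunctor ⋙ T.toFunctor ⟶ T.toFunctor ⋙ S.toFunctor
  unit_left (X : C) : T.η.app (S.obj X) ≫ law.app X = S.map (T.η.app X)
  unit_right (X : C) : T.map (S.η.app X) ≫ law.app X = S.η.app (T.obj X)
  mul_right (X : C) : T.map (S.μ.app X) ≫ law.app X =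
    law.app (S.obj X) ≫ S.map (law.app X) ≫ S.μ.app (T.obj X)
  mul_left (X : C) : T.μ.app (S.obj X) ≫ law.app X =
    T.map (law.app X) ≫ law.app (T.obj X) ≫ S.map (T.μ.app X)

lemma DistributiveLaw.natural {T S : Monad C} (l : DistributiveLaw T S) {X Y : C} (f : X ⟶ Y) :
    T.map (S.map f) ≫ l.law.app Y = l.law.app X ≫ S.map (T.map f) :=
  l.law.naturality f

/-- The composite monad `S T` determined by a distributive law `T S ⟶ S T`. -/
def DistributiveLaw.compMonad {T S : Monad C} (l : DistributiveLaw T S) : Monad C where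
  toFunctor := T.toFunctor ⋙ S.toFunctor
  η :=
    { app := fun X => T.η.app X ≫ S.η.app (T.obj X)
      naturality := by
        intro X Y f
        have h1 := T.η.naturality f
        have h2 := S.η.naturality (T.map f)
        simp only [Functor.id_obj, Functor.id_map, Functor.comp_obj, Functor.comp_map] at h1 h2 ⊢
        rw [reassoc_of% h1, h2, Category.assoc] }
  μ :=
    { app := fun X => S.map (l.law.app (T.obj X)) ≫ S.map (S.map (T.μ.app X)) ≫
        S.μ.app (T.obj X)
      naturality := by
        intro X Y f
        have h1 := l.natural (T.map f)
        have h2 := T.mu_naturality C f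
        have h3 := S.mu_naturality C (T.map f)
        simp only [Functor.comp_obj, Functor.comp_map, Category.assoc]
        rw [← h3, ← S.map_comp_assoc, h1]
        simp only [← S.map_comp_assoc, Category.assoc, ← S.map_comp, h2] }
  assoc := by
    intro X
    have e1 := l.mul_right (T.obj X)
    have e2 := l.natural (S.map (T.μ.app X))
    have e3 := l.natural (T.μ.app X)
    have e4 := l.mul_left (T.obj X)
    have e5 := l.natural (l.law.app (T.obj X))
    have e6 := S.mu_naturality C (l.law.app (T.obj X))
    have e8 := S.mu_naturality C (S.map (T.μ.app (T.obj X)))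
    have e9 := S.mu_naturality C (T.μ.app (T.obj X))
    have e10 := S.mu_naturality C (T.μ.app X)
    have e11 := S.assoc (T.obj (T.obj (T.obj X)))
    dsimp only [Functor.comp_obj] at e1 e2 e3 e4 e5 e6 e8 e9 e10 e11
    have f1 := congrArg (fun x => S.map x) e1
    have f2 := congrArg (fun x => S.map x) e2
    have f3 := congrArg (fun x => S.map (S.map x)) e3
    have f4 := congrArg (fun x => S.map (S.map x)) e4
    have f5 := congrArg (fun x => S.map x) e5
    have f7 := congrArg (fun x => S.map x) (S.mu_naturality C (T.map (T.μ.app X)))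
    have f12 := congrArg (fun x => S.map (S.map x)) (T.assoc X)
    simp only [Functor.comp_obj, Functor.comp_map, Functor.map_comp, Category.assoc]
      at f1 f2 f3 f4 f5 f7 f12 ⊢
    rw [reassoc_of% f1, reassoc_of% f2, reassoc_of% f3, ← reassoc_of% e6, reassoc_of% f4,
      ← reassoc_of% f5, reassoc_of% f7, reassoc_of% f12, e10, reassoc_of% e9, reassoc_of% e8,
      reassoc_of% e9, reassoc_of% e11]
  left_unit := by
    intro X
    have e1 := l.unit_left (T.obj X)
    have e2 := S.η.naturality (l.law.app (T.obj X))
    have e3 := S.η.naturality (S.map (T.μ.app X))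
    have e4 := T.left_unit X
    have e5 := S.left_unit (T.obj X)
    have f4 := congrArg (fun x => S.map x) e4
    simp only [Functor.comp_obj, Functor.id_obj, Functor.id_map, Functor.map_comp, Category.assoc]
      at e1 e2 e3 e4 e5 f4 ⊢
    rw [← reassoc_of% e2, ← reassoc_of% e3, reassoc_of% e1, reassoc_of% f4, e5, S.map_id]
    exact Category.comp_id _
  right_unit := by
    intro X
    have e1 := l.unit_right (T.obj X)
    have e2 := T.right_unit X
    have e3 := S.η.naturality (T.μ.app X)
    have e4 := S.right_unit (T.obj X)
    have f1 := congrArg (fun x => S.map x) e1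
    have f2 := congrArg (fun x => S.map x) e2
    have f3 := congrArg (fun x => S.map x) e3
    simp only [Functor.comp_obj, Functor.comp_map, Functor.id_obj, Functor.id_map,
      Functor.map_comp, Category.assoc] at e1 e2 e3 e4 f1 f2 f3 ⊢
    rw [reassoc_of% f1, ← reassoc_of% f3, reassoc_of% f2, e4, S.map_id]
    exact Category.comp_id _

/-- A BD-law on a monad: a distributive law of the monad over itself which satisfies the
Yang-Baxter equation. -/
structure BDLaw (F : Monad C) extends DistributiveLaw F F where
  yangBaxter (X : C) :
    F.map (law.app X) ≫ law.app (F.obj X) ≫ F.map (law.app X) =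
      law.app (F.obj X) ≫ F.map (law.app X) ≫ law.app (F.obj X)

namespace BDLaw

variable {F : Monad C} (l : BDLaw F)

/-- The opposite monad, with multiplication `m · λ`. -/
def oppMonad : Monad C where
  toFunctor := F.toFunctor
  η := F.η
  μ := l.law ≫ F.μ
  assoc := by
    intro X
    have h1 := l.mul_right X
    have h2 := l.mul_left X
    have h3 := l.yangBaxter X
    have h4 := F.assoc X
    simp only [NatTrans.comp_app, Functor.map_comp, Category.assoc]
    rw [reassoc_of% h1, reassoc_of% h2, ← reassoc_of% h3, ← h4]
  left_unit := by
    intro X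
    have h1 := l.unit_left X
    simp only [NatTrans.comp_app, reassoc_of% h1, F.right_unit]
    rfl
  right_unit := by
    intro X
    have h1 := l.unit_right X
    simp only [NatTrans.comp_app, reassoc_of% h1, F.left_unit]
    rfl

/-- The transformation underlying a BD-law on `F` is also a distributive law of the opposite
monad of `F` over `F`. -/
def oppDistributiveLaw : DistributiveLaw l.oppMonad F where
  law := l.law
  unit_left := l.unit_left
  unit_right := l.unit_right
  mul_right := l.mul_right
  mul_left := by
    intro X
    have h2 := l.mul_left X
    have h3 := l.yangBaxter X
    simp only [oppMonad, NatTrans.comp_app, Functor.map_comp, Category.assoc]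
    rw [h2, ← reassoc_of% h3]

/-- The comparison functor from `C` to the Eilenberg-Moore category of the composite of `F` with
its opposite monad; it sends `X` to `F X` with the action `m · F m · F λ`. -/
def comparison : C ⥤ l.oppDistributiveLaw.compMonad.Algebra where
  obj X :=
    { A := F.obj X
      a := (F.map (l.law.app X) ≫ F.map (F.μ.app X) ≫ F.μ.app X :
        F.obj (F.obj (F.obj X)) ⟶ F.obj X)
      unit := by
        have e1 := F.η.naturality (l.law.app X)
        have e2 := F.η.naturality (F.μ.app X)
        have e3 := l.unit_left X
        have e4 := F.left_unit (X)
        have e5 := F.right_unit (X)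
        change (F.η.app (F.obj X) ≫ F.η.app (F.obj (F.obj X))) ≫
          F.map (l.law.app X) ≫ F.map (F.μ.app X) ≫ F.μ.app X = 𝟙 (F.obj X)
        simp only [Functor.comp_obj, Functor.id_obj, Functor.id_map, Category.assoc]
          at e1 e2 e3 e4 e5 ⊢
        rw [← reassoc_of% e1, ← reassoc_of% e2, e4, Category.comp_id, reassoc_of% e3, e5]
      assoc := by
        have e1 := l.oppMonad.assoc X
        have e2 : F.map (F.μ.app X) ≫ l.law.app X ≫ F.μ.app X = l.law.app (F.obj X) ≫
            F.map (l.law.app X ≫ F.μ.app X) ≫ F.μ.app X := by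
          have h1 := l.mul_right X
          rw [reassoc_of% h1, ← F.assoc, F.map_comp_assoc]
        have e3 := F.assoc X
        have e4 := F.mu_naturality C (l.law.app X ≫ F.μ.app X)
        have e5 := l.natural (l.law.app X ≫ F.μ.app X)
        change F.map (l.law.app X ≫ F.μ.app X) ≫ l.law.app X ≫ F.μ.app X =
          (l.law.app (F.obj X) ≫ F.μ.app (F.obj X)) ≫ l.law.app X ≫ F.μ.app X at e1
        have f1 := congrArg (fun x => F.map (F.map x)) e1
        have f2 := congrArg (fun x => F.map x) e2
        have f5 := congrArg (fun x => F.map x) e5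
        change (F.map (l.law.app (F.obj (F.obj X))) ≫
            F.map (F.map (l.law.app (F.obj X) ≫ F.μ.app (F.obj X))) ≫
            F.μ.app (F.obj (F.obj X))) ≫
            F.map (l.law.app X) ≫ F.map (F.μ.app X) ≫ F.μ.app X =
          F.map (F.map (F.map (l.law.app X) ≫ F.map (F.μ.app X) ≫ F.μ.app X)) ≫
            F.map (l.law.app X) ≫ F.map (F.μ.app X) ≫ F.μ.app X
        simp only [Functor.comp_obj, Functor.map_comp, Category.assoc] at f1 f2 f5 e3 e4 ⊢
        rw [reassoc_of% f2, reassoc_of% f5, ← reassoc_of% e4, reassoc_of% f1, e3] }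
  map {X Y} f :=
    { f := F.map f
      h := by
        have e1 := l.natural f
        have e2 := F.mu_naturality C f
        change F.map (F.map (F.map f)) ≫ F.map (l.law.app Y) ≫ F.map (F.μ.app Y) ≫ F.μ.app Y =
          (F.map (l.law.app X) ≫ F.map (F.μ.app X) ≫ F.μ.app X) ≫ F.map f
        rw [← F.map_comp_assoc, e1, F.map_comp_assoc, ← F.map_comp_assoc (F.map (F.map f)), e2,
          F.map_comp_assoc, e2]
        simp only [Category.assoc] }
  map_id := by
    intro X
    ext
    exact F.map_id X
  map_comp := by
    intro X Y Z f g
    ext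
    exact F.map_comp f g

/-- The monad `F`, with the given BD-law, is Azumaya: its comparison functor is an equivalence. -/
def IsAzumaya : Prop := l.comparison.IsEquivalence

end BDLaw

end Monads

section Monoidal

variable {C : Type u} [Category.{v} C] [MonoidalCategory C]

/-- The monad `A ⊗ -` of an algebra `A`. -/
def leftMonad (A : C) [MonObj A] : Monad C where
  toFunctor := tensorLeft A
  η :=
    { app := fun X => (λ_ X).inv ≫ (MonObj.one : 𝟙_ C ⟶ A) ▷ X
      naturality := by
        intro X Y f
        simp [← whisker_exchange] }
  μ :=
    { app := fun X => (α_ A A X).inv ≫ (MonObj.mul : A ⊗ A ⟶ A) ▷ X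
      naturality := by
        intro X Y f
        simp [← whisker_exchange] }
  assoc X := by
    change A ◁ ((α_ A A X).inv ≫ (MonObj.mul : A ⊗ A ⟶ A) ▷ X) ≫ (α_ A A X).inv ≫
        (MonObj.mul : A ⊗ A ⟶ A) ▷ X =
      ((α_ A A (A ⊗ X)).inv ≫ (MonObj.mul : A ⊗ A ⟶ A) ▷ (A ⊗ X)) ≫ (α_ A A X).inv ≫
        (MonObj.mul : A ⊗ A ⟶ A) ▷ X
    have h := MonObj.mul_assoc_flip A
    calc _ = 𝟙 _ ⊗≫ (A ◁ (MonObj.mul : A ⊗ A ⟶ A) ≫ MonObj.mul) ▷ X := by monoidal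
      _ = _ := by rw [h]; monoidal
  left_unit X := by
    change ((λ_ (A ⊗ X)).inv ≫ (MonObj.one : 𝟙_ C ⟶ A) ▷ (A ⊗ X)) ≫ (α_ A A X).inv ≫
      (MonObj.mul : A ⊗ A ⟶ A) ▷ X = 𝟙 _
    calc _ = 𝟙 _ ⊗≫ ((MonObj.one : 𝟙_ C ⟶ A) ▷ A ≫ MonObj.mul) ▷ X := by monoidal
      _ = _ := by rw [MonObj.one_mul]; monoidal
  right_unit X := by
    change A ◁ ((λ_ X).inv ≫ (MonObj.one : 𝟙_ C ⟶ A) ▷ X) ≫ (α_ A A X).inv ≫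
      (MonObj.mul : A ⊗ A ⟶ A) ▷ X = 𝟙 _
    calc _ = 𝟙 _ ⊗≫ (A ◁ (MonObj.one : 𝟙_ C ⟶ A) ≫ MonObj.mul) ▷ X := by monoidal
      _ = _ := by rw [MonObj.mul_one]; monoidal

/-- A morphism `f` is a pure monomorphism if `f ⊗ Z` is a regular monomorphism for every `Z`. -/
def IsPureMono {X Y : C} (f : X ⟶ Y) : Prop :=
  ∀ Z : C, IsRegularMono (f ▷ Z)

variable [BraidedCategory C]

/-- The morphism `τ_{A,A} ⊗ X`, where `τ` is the braiding. -/
def tau (A X : C) : A ⊗ (A ⊗ X) ⟶ A ⊗ (A ⊗ X) :=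
  (α_ A A X).inv ≫ (β_ A A).hom ▷ X ≫ (α_ A A X).hom

lemma tau_natural (A : C) {X Y : C} (f : X ⟶ Y) :
    A ◁ A ◁ f ≫ tau A Y = tau A X ≫ A ◁ A ◁ f := by
  simp only [tau]
  simp only [Category.assoc, associator_inv_naturality_right_assoc, whisker_exchange_assoc,
    associator_naturality_right]

lemma tau_unit_left (A : C) [MonObj A] (X : C) :
    ((λ_ (A ⊗ X)).inv ≫ (MonObj.one : 𝟙_ C ⟶ A) ▷ (A ⊗ X)) ≫ tau A X =
      A ◁ ((λ_ X).inv ≫ (MonObj.one : 𝟙_ C ⟶ A) ▷ X) := by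
  have h := BraidedCategory.braiding_naturality_left (MonObj.one : 𝟙_ C ⟶ A) A
  rw [braiding_tensorUnit_left] at h
  calc _ = 𝟙 _ ⊗≫ ((MonObj.one : 𝟙_ C ⟶ A) ▷ A ≫ (β_ A A).hom) ▷ X ⊗≫ 𝟙 _ := by
        rw [tau]; monoidal
    _ = _ := by rw [h]; monoidal

lemma tau_unit_right (A : C) [MonObj A] (X : C) :
    A ◁ ((λ_ X).inv ≫ (MonObj.one : 𝟙_ C ⟶ A) ▷ X) ≫ tau A X =
      (λ_ (A ⊗ X)).inv ≫ (MonObj.one : 𝟙_ C ⟶ A) ▷ (A ⊗ X) := by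
  have h := BraidedCategory.braiding_naturality_right A (MonObj.one : 𝟙_ C ⟶ A)
  rw [braiding_tensorUnit_right] at h
  calc _ = 𝟙 _ ⊗≫ (A ◁ (MonObj.one : 𝟙_ C ⟶ A) ≫ (β_ A A).hom) ▷ X ⊗≫ 𝟙 _ := by
        rw [tau]; monoidal
    _ = _ := by rw [h]; monoidal

lemma tau_mul_right (A : C) [MonObj A] (X : C) :
    A ◁ ((α_ A A X).inv ≫ (MonObj.mul : A ⊗ A ⟶ A) ▷ X) ≫ tau A X =
      tau A (A ⊗ X) ≫ A ◁ tau A X ≫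
        (α_ A A (A ⊗ X)).inv ≫ (MonObj.mul : A ⊗ A ⟶ A) ▷ (A ⊗ X) := by
  have h := BraidedCategory.braiding_naturality_right A (MonObj.mul : A ⊗ A ⟶ A)
  rw [BraidedCategory.braiding_tensor_right_hom] at h
  calc _ = 𝟙 _ ⊗≫ (A ◁ (MonObj.mul : A ⊗ A ⟶ A) ≫ (β_ A A).hom) ▷ X ⊗≫ 𝟙 _ := by
        rw [tau]; monoidal
    _ = _ := by rw [h, tau, tau]; monoidal

lemma tau_mul_left (A : C) [MonObj A] (X : C) :
    ((α_ A A (A ⊗ X)).inv ≫ (MonObj.mul : A ⊗ A ⟶ A) ▷ (A ⊗ X)) ≫ tau A X =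
      A ◁ tau A X ≫ tau A (A ⊗ X) ≫
        A ◁ ((α_ A A X).inv ≫ (MonObj.mul : A ⊗ A ⟶ A) ▷ X) := by
  have h := BraidedCategory.braiding_naturality_left (MonObj.mul : A ⊗ A ⟶ A) A
  rw [BraidedCategory.braiding_tensor_left_hom] at h
  calc _ = 𝟙 _ ⊗≫ ((MonObj.mul : A ⊗ A ⟶ A) ▷ A ≫ (β_ A A).hom) ▷ X ⊗≫ 𝟙 _ := by
        rw [tau]; monoidal
    _ = _ := by rw [h, tau, tau]; monoidal

lemma tau_yangBaxter (A X : C) :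
    A ◁ tau A X ≫ tau A (A ⊗ X) ≫ A ◁ tau A X =
      tau A (A ⊗ X) ≫ A ◁ tau A X ≫ tau A (A ⊗ X) := by
  have h := BraidedCategory.yang_baxter A A A
  calc _ = 𝟙 _ ⊗≫ (A ◁ (β_ A A).hom ≫ (α_ A A A).inv ≫ (β_ A A).hom ▷ A ≫ (α_ A A A).hom ≫
        A ◁ (β_ A A).hom) ▷ X ⊗≫ 𝟙 _ := by
        rw [tau, tau]; monoidal
    _ = _ := by rw [← h, tau, tau]; monoidal

/-- The braiding `τ_{A,A}` as a BD-law on the monad `A ⊗ -`. -/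
def braidingBDLaw (A : C) [MonObj A] : BDLaw (leftMonad A) where
  law :=
    { app := fun X => tau A X
      naturality := fun _ _ f => tau_natural A f }
  unit_left := tau_unit_left A
  unit_right := tau_unit_right A
  mul_right := tau_mul_right A
  mul_left := tau_mul_left A
  yangBaxter := tau_yangBaxter A

/-- An algebra `A` in a braided monoidal category is left Azumaya if the monad `A ⊗ -`, with the
BD-law given by the braiding, is Azumaya. -/
def IsLeftAzumaya (A : C) [MonObj A] : Prop := (braidingBDLaw A).IsAzumaya

lemma opp_mul_assoc (A : C) [MonObj A] :
    ((β_ A A).hom ≫ (MonObj.mul : A ⊗ A ⟶ A)) ▷ A ≫ (β_ A A).hom ≫ MonObj.mul =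
      (α_ A A A).hom ≫ A ◁ ((β_ A A).hom ≫ (MonObj.mul : A ⊗ A ⟶ A)) ≫
        (β_ A A).hom ≫ MonObj.mul := by
  have h1 := BraidedCategory.braiding_naturality_left (MonObj.mul : A ⊗ A ⟶ A) A
  have h2 := BraidedCategory.braiding_naturality_right A (MonObj.mul : A ⊗ A ⟶ A)
  have h := BraidedCategory.yang_baxter A A A
  simp only [comp_whiskerRight, whiskerLeft_comp, Category.assoc, reassoc_of% h1, reassoc_of% h2,
    MonObj.mul_assoc, BraidedCategory.braiding_tensor_left_hom,
    BraidedCategory.braiding_tensor_right_hom]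
  rw [← cancel_epi (α_ A A A).inv]
  simp [reassoc_of% h]

/-- The underlying object of the opposite algebra. -/
def Opp (A : C) : C := A

/-- The opposite algebra, with multiplication `m · τ_{A,A}` and the same unit. -/
instance (A : C) [MonObj A] : MonObj (Opp A) where
  one := (MonObj.one : 𝟙_ C ⟶ A)
  mul := ((β_ A A).hom ≫ (MonObj.mul : A ⊗ A ⟶ A) : A ⊗ A ⟶ A)
  one_mul := by
    change (MonObj.one : 𝟙_ C ⟶ A) ▷ A ≫ (β_ A A).hom ≫ MonObj.mul = (λ_ A).hom
    simp
  mul_one := by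
    change A ◁ (MonObj.one : 𝟙_ C ⟶ A) ≫ (β_ A A).hom ≫ MonObj.mul = (ρ_ A).hom
    simp
  mul_assoc := opp_mul_assoc A

/-- The enveloping algebra `A ⊗ Aᵒᵖ`, as a braided tensor product of algebras, with multiplication
`(m ⊗ m · τ) · (A ⊗ τ_{A,A} ⊗ A)`. -/
abbrev Env (A : C) : C := A ⊗ Opp A

section Invariants

variable (A : C) [MonObj A] (M : Mod C (Env A))

/-- The structure morphism `h : A ⊗ A ⊗ V ⟶ V` of a left module `(V, h)` over `A ⊗ Aᵒᵖ`. -/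
def envAct : (A ⊗ A) ⊗ M.X ⟶ M.X := ModObj.smul (M := Env A) (X := M.X)

/-- The composite `A ⊗ V ⟶ A ⊗ A ⊗ V ⟶ V` of `A ⊗ e ⊗ V` and `h`. -/
def firstAct : A ⊗ M.X ⟶ M.X :=
  (ρ_ A).inv ▷ M.X ≫ (A ◁ (MonObj.one : 𝟙_ C ⟶ A)) ▷ M.X ≫ envAct A M

/-- The composite `A ⊗ V ⟶ A ⊗ A ⊗ V ⟶ V` of `e ⊗ A ⊗ V` and `h`. -/
def secondAct : A ⊗ M.X ⟶ M.X :=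
  (λ_ A).inv ▷ M.X ≫ ((MonObj.one : 𝟙_ C ⟶ A) ▷ A) ▷ M.X ≫ envAct A M

variable [MonoidalClosed C] [HasEqualizers C]

/-- The invariants of an `A ⊗ Aᵒᵖ`-module `(V, h)`: the equaliser of the two morphisms
`V ⟶ [A, A ⊗ V] ⟶ [A, A ⊗ A ⊗ V] ⟶ [A, V]` induced by `e ⊗ A ⊗ V` and `A ⊗ e ⊗ V`. -/
noncomputable def invariants : C :=
  equalizer
    ((ihom.coev A).app M.X ≫ (ihom A).map (secondAct A M))
    ((ihom.coev A).app M.X ≫ (ihom A).map (firstAct A M))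

/-- The canonical inclusion of the invariants. -/
noncomputable def invariantsInclusion : invariants A M ⟶ M.X :=
  equalizer.ι
    ((ihom.coev A).app M.X ≫ (ihom A).map (secondAct A M))
    ((ihom.coev A).app M.X ≫ (ihom A).map (firstAct A M))

/-- The composite `h · (A ⊗ e ⊗ V) · (A ⊗ i)`, where `i` is the inclusion of the invariants. -/
noncomputable def invariantsMap : A ⊗ invariants A M ⟶ M.X :=
  A ◁ invariantsInclusion A M ≫ firstAct A M

end Invariants

end Monoidal

end AzumayaTheory

/-! The comparison functor `K` has a right adjoint, given by invariants. A module morphism `φ : A ⊗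
X ⟶ V` is determined by its restriction `g : X ⟶ V` along `e ⊗ X`, and the morphisms `g` that arise
are exactly those on which the two factors of the enveloping algebra act alike
(`BDLaw.comparisonHomEquiv`). Transposed across `A ⊗ - ⊣ [A, -]`, this condition says that `g`
factors through the equaliser of invariants (`invariantsEquiv`).

The counit of this adjunction is the composite in condition 2, and its unit followed by the
inclusion of invariants is `e ⊗ X`. If `K` is an equivalence, the counit is invertible and `e ⊗ X`
is an isomorphism followed by an equaliser, hence a regular monomorphism. Conversely, if the counit
is invertible, a triangle identity makes `A ⊗ unit` invertible; purity of `e` makes `A ⊗ -` reflect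
isomorphisms (`isIso_of_isIso_whiskerLeft`), so the unit is invertible too. -/

namespace AzumayaTheory

/-! ### Algebras over the composite monad as pairs of actions -/

section Monads

variable {C : Type u} [Category.{v} C]

namespace BDLaw

variable {F : Monad C} (l : BDLaw F) (N : l.oppDistributiveLaw.compMonad.Algebra)

/-- The structure morphism of an algebra over the composite of `F` with its opposite monad. -/
def act : F.obj (F.obj N.A) ⟶ N.A := N.a

/-- The `F`-action underlying an algebra over the composite of `F` with its opposite monad. -/
def leftAct : F.obj N.A ⟶ N.A := F.map (F.η.app N.A) ≫ l.act N

/-- The action of the opposite monad of `F` underlying an algebra over the composite of `F` with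
its opposite monad. -/
def rightAct : F.obj N.A ⟶ N.A := F.η.app (F.obj N.A) ≫ l.act N

lemma act_assoc :
    F.map (F.map (l.act N)) ≫ l.act N =
      F.map (l.law.app (F.obj N.A)) ≫ F.map (F.map (l.law.app N.A ≫ F.μ.app N.A)) ≫
        F.μ.app (F.obj N.A) ≫ l.act N := by
  refine N.assoc.symm.trans ?_
  change (F.map (l.law.app (F.obj N.A)) ≫ F.map (F.map (l.law.app N.A ≫ F.μ.app N.A)) ≫
    F.μ.app (F.obj N.A)) ≫ l.act N = _
  simp only [Category.assoc]

/-- Unit laws of the opposite monad: the law slides the unit to the other side, where a unit law of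
`F` applies. -/
lemma unit_law_mul (X : C) : F.map (F.η.app X) ≫ l.law.app X ≫ F.μ.app X = 𝟙 (F.obj X) := by
  have h := l.unit_right X
  rw [reassoc_of% h]
  exact F.left_unit X

lemma unit_law_mul' (X : C) :
    F.η.app (F.obj X) ≫ l.law.app X ≫ F.μ.app X = 𝟙 (F.obj X) := by
  have h := l.unit_left X
  rw [reassoc_of% h]
  exact F.right_unit X

lemma unit_leftAct : F.η.app N.A ≫ l.leftAct N = 𝟙 N.A := by
  have h := F.η.naturality (F.η.app N.A)
  have h2 : (F.η.app N.A ≫ F.η.app (F.obj N.A)) ≫ l.act N = 𝟙 N.A := N.unit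
  simp only [Functor.id_map, Functor.id_obj] at h
  rw [leftAct, ← reassoc_of% h, ← h2, Category.assoc]

/-- The left action inserts a unit in the second slot; the law carries it past the next factor, and
the opposite multiplication then absorbs it. -/
lemma map_act_leftAct : F.map (l.act N) ≫ l.leftAct N = F.μ.app (F.obj N.A) ≫ l.act N := by
  have h1 := F.η.naturality (l.act N)
  have h2 := l.unit_left (F.obj N.A)
  have h3 := l.unit_law_mul' N.A
  simp only [Functor.id_map, Functor.id_obj] at h1
  rw [leftAct, ← F.map_comp_assoc, h1, F.map_comp_assoc, act_assoc, ← F.map_comp_assoc, h2,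
    ← F.map_comp_assoc, ← F.map_comp, h3]
  simp only [Functor.id_obj, F.map_id, Category.id_comp]

lemma map_rightAct_leftAct : F.map (l.rightAct N) ≫ l.leftAct N = l.act N := by
  rw [rightAct, F.map_comp, Category.assoc, map_act_leftAct, ← Category.assoc, F.right_unit]
  exact Category.id_comp _

lemma map_leftAct_leftAct :
    F.map (l.leftAct N) ≫ l.leftAct N = F.μ.app N.A ≫ l.leftAct N := by
  have h := F.mu_naturality C (F.η.app N.A)
  conv_lhs => rw [leftAct, F.map_comp, Category.assoc, ← leftAct, map_act_leftAct]
  rw [reassoc_of% h, leftAct]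

/-- The interchange rule for the two actions. Both outer slots are filled with units, so
associativity of the full action leaves only the law between the two remaining factors. -/
lemma map_leftAct_rightAct :
    F.map (l.leftAct N) ≫ l.rightAct N = l.law.app N.A ≫ l.act N := by
  have h1 := F.η.naturality (F.map (l.leftAct N))
  have h2 := F.η.naturality (l.law.app (F.obj N.A))
  have h3 := F.η.naturality (F.map (l.law.app N.A ≫ F.μ.app N.A))
  have h4 := F.left_unit (F.obj N.A)
  have h5 := l.natural (F.η.app N.A)
  have h6 := l.unit_law_mul N.A
  have h7 := F.η.naturality (F.map (F.map (F.η.app N.A)))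
  simp only [Functor.id_map, Functor.id_obj, Functor.comp_obj] at h1 h2 h3 h4 h5 h6 h7
  rw [rightAct, reassoc_of% h1, leftAct, F.map_comp, F.map_comp, Category.assoc, act_assoc,
    ← reassoc_of% h7, ← reassoc_of% h2, ← reassoc_of% h3, reassoc_of% h4, reassoc_of% h5,
    ← F.map_comp_assoc, h6, F.map_id, Category.id_comp]

variable {N}

lemma map_comp_act_comparison {X : C} (φ : l.comparison.obj X ⟶ N) :
    F.map (F.map φ.f) ≫ l.act N =
      F.map (l.law.app X ≫ F.μ.app X) ≫ F.μ.app X ≫ φ.f := by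
  refine φ.h.trans ?_
  rw [F.map_comp, Category.assoc]
  exact (Category.assoc _ _ _).trans (congrArg _ (Category.assoc _ _ _))

/-- In element notation `φ (a ⊗ x) = a · φ (e ⊗ x)`: the left action on a free object is
multiplication, and `a e = a`. -/
lemma map_unit_comp_leftAct {X : C} (φ : F.obj X ⟶ N.A)
    (hφ : F.map (F.map φ) ≫ l.act N = F.map (l.law.app X ≫ F.μ.app X) ≫ F.μ.app X ≫ φ) :
    F.map (F.η.app X ≫ φ) ≫ l.leftAct N = φ := by
  have h1 := F.η.naturality φ
  have h2 := l.unit_law_mul' X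
  have h3 := F.right_unit X
  simp only [Functor.id_map, Functor.id_obj] at h1
  rw [leftAct, ← F.map_comp_assoc, Category.assoc, h1, F.map_comp_assoc, F.map_comp_assoc, hφ,
    ← F.map_comp_assoc (F.η.app (F.obj X)), h2]
  simp only [Functor.id_obj, F.map_id, Category.id_comp]
  rw [reassoc_of% h3]

/-- The opposite action on a free object is `m · λ`, which also returns `a` when applied to `a` and
`e`. Hence both actions agree on the restriction of `φ` along the unit. -/
lemma map_unit_comp_rightAct {X : C} (φ : F.obj X ⟶ N.A)
    (hφ : F.map (F.map φ) ≫ l.act N = F.map (l.law.app X ≫ F.μ.app X) ≫ F.μ.app X ≫ φ) :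
    F.map (F.η.app X ≫ φ) ≫ l.rightAct N = φ := by
  have h1 := F.η.naturality (F.map φ)
  have h2 := l.unit_law_mul X
  have h3 := F.left_unit X
  have h4 := F.η.naturality (l.law.app X ≫ F.μ.app X)
  simp only [Functor.id_map, Functor.id_obj, Functor.comp_obj] at h1 h4
  rw [rightAct, F.map_comp_assoc, reassoc_of% h1, hφ, ← reassoc_of% h4, reassoc_of% h2,
    reassoc_of% h3]

/-- The converse extension: compatibility with the left action is automatic from its associativity,
so the hypothesis `hg` is needed only for the opposite action. -/
lemma map_leftAct_act {X : C} (g : X ⟶ N.A)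
    (hg : F.map g ≫ l.rightAct N = F.map g ≫ l.leftAct N) :
    F.map (F.map (F.map g ≫ l.leftAct N)) ≫ l.act N =
      F.map (l.law.app X ≫ F.μ.app X) ≫ F.μ.app X ≫ F.map g ≫ l.leftAct N := by
  have h1 := l.natural g
  have h2 := F.mu_naturality C g
  -- Interchange moves the opposite action next to `g`, where `hg` turns it into the left action;
  -- the two left actions then multiply.
  have h3 : F.map (F.map g ≫ l.leftAct N) ≫ l.rightAct N =
      l.law.app X ≫ F.μ.app X ≫ F.map g ≫ l.leftAct N := by
    rw [F.map_comp, Category.assoc, map_leftAct_rightAct, reassoc_of% h1,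
      ← map_rightAct_leftAct, ← F.map_comp_assoc, hg, F.map_comp_assoc, map_leftAct_leftAct,
      reassoc_of% h2]
  rw [← map_rightAct_leftAct, ← F.map_comp_assoc, h3, ← Category.assoc (l.law.app X),
    F.map_comp_assoc, F.map_comp_assoc (F.map g), map_leftAct_leftAct, reassoc_of% h2]

variable (N)

/-- Morphisms out of a value of the comparison functor correspond to morphisms in `C` on which the
two underlying actions agree. -/
def comparisonHomEquiv (X : C) : (l.comparison.obj X ⟶ N) ≃
    {g : X ⟶ N.A // F.map g ≫ l.rightAct N = F.map g ≫ l.leftAct N} where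
  toFun φ := ⟨F.η.app X ≫ φ.f,
    (l.map_unit_comp_rightAct φ.f (l.map_comp_act_comparison φ)).trans
      (l.map_unit_comp_leftAct φ.f (l.map_comp_act_comparison φ)).symm⟩
  invFun g :=
    { f := F.map g.1 ≫ l.leftAct N
      h := by
        refine (l.map_leftAct_act g.1 g.2).trans ?_
        rw [F.map_comp, Category.assoc]
        exact ((Category.assoc _ _ _).trans (congrArg _ (Category.assoc _ _ _))).symm }
  left_inv φ := by
    ext
    exact l.map_unit_comp_leftAct φ.f (l.map_comp_act_comparison φ)
  right_inv g := by
    have h := F.η.naturality g.1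
    simp only [Functor.id_map, Functor.id_obj] at h
    apply Subtype.ext
    change F.η.app X ≫ F.map g.1 ≫ l.leftAct N = g.1
    rw [← reassoc_of% h, unit_leftAct, Category.comp_id]

end BDLaw

end Monads

/-! ### Transposition, and reflection of isomorphisms by `A ⊗ -` -/

section Monoidal

variable {C : Type u} [Category.{v} C] [MonoidalCategory C]

lemma comp_coev_map_eq_iff [MonoidalClosed C] {A X Y Z : C} (f : X ⟶ Y) (p q : A ⊗ Y ⟶ Z) :
    f ≫ (ihom.coev A).app Y ≫ (ihom A).map p = f ≫ (ihom.coev A).app Y ≫ (ihom A).map q ↔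
      A ◁ f ≫ p = A ◁ f ≫ q := by
  rw [← MonoidalClosed.curry_eq, ← MonoidalClosed.curry_eq, ← MonoidalClosed.curry_natural_left,
    ← MonoidalClosed.curry_natural_left, MonoidalClosed.curry_injective.eq_iff]

/-- Tensoring with an algebra whose unit is a pure monomorphism reflects isomorphisms. -/
lemma isIso_of_isIso_whiskerLeft {A : C} [MonObj A]
    (hA : IsPureMono (MonObj.one : 𝟙_ C ⟶ A)) {X Y : C}
    (f : X ⟶ Y) [IsIso (A ◁ f)] : IsIso f := by
  have hm (Z : C) : IsRegularMono ((λ_ Z).inv ≫ (MonObj.one : 𝟙_ C ⟶ A) ▷ Z) := by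
    have := hA Z
    exact (MorphismProperty.cancel_left_of_respectsIso (MorphismProperty.regularMono C) _ _).2 this
  have hn {Z W : C} (g : Z ⟶ W) : g ≫ (λ_ W).inv ≫ (MonObj.one : 𝟙_ C ⟶ A) ▷ W =
      ((λ_ Z).inv ≫ (MonObj.one : 𝟙_ C ⟶ A) ▷ Z) ≫ A ◁ g := (leftMonad A).η.naturality g
  -- By naturality of the unit this is a regular monomorphism followed by the isomorphism `A ◁ f`.
  have : StrongMono (f ≫ (λ_ Y).inv ≫ (MonObj.one : 𝟙_ C ⟶ A) ▷ Y) := by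
    have := hm X
    rw [hn]
    exact strongMono_comp _ _
  have : StrongMono f := strongMono_of_strongMono f ((λ_ Y).inv ≫ (MonObj.one : 𝟙_ C ⟶ A) ▷ Y)
  -- Since `e ⊗ Z` is monic, `A ⊗ -` is faithful and so reflects epimorphisms.
  have : Epi f := by
    constructor
    intro Z a b hab
    have := hm Z
    have hab' : A ◁ a = A ◁ b := by
      rw [← cancel_epi (A ◁ f), ← whiskerLeft_comp, ← whiskerLeft_comp, hab]
    rw [← cancel_mono ((λ_ Z).inv ≫ (MonObj.one : 𝟙_ C ⟶ A) ▷ Z), hn, hn, hab']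
  exact isIso_of_epi_of_strongMono f

lemma leftAct_eq_of_comp {A X : C} [MonObj A] (h : (A ⊗ A) ⊗ X ⟶ X) (a : A ⊗ A ⊗ X ⟶ X)
    (ha : (α_ A A X).hom ≫ a = h) :
    (ρ_ A).inv ▷ X ≫ (A ◁ (MonObj.one : 𝟙_ C ⟶ A)) ▷ X ≫ h =
      A ◁ ((λ_ X).inv ≫ (MonObj.one : 𝟙_ C ⟶ A) ▷ X) ≫ a := by
  simp [← ha]

lemma rightAct_eq_of_comp {A X : C} [MonObj A] (h : (A ⊗ A) ⊗ X ⟶ X) (a : A ⊗ A ⊗ X ⟶ X)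
    (ha : (α_ A A X).hom ≫ a = h) :
    (λ_ A).inv ▷ X ≫ ((MonObj.one : 𝟙_ C ⟶ A) ▷ A) ▷ X ≫ h =
      ((λ_ (A ⊗ X)).inv ≫ (MonObj.one : 𝟙_ C ⟶ A) ▷ (A ⊗ X)) ≫ a := by
  simp [← ha]

/-! ### Modules over the enveloping algebra as algebras over the composite monad -/

variable [BraidedCategory C] (A : C) [MonObj A]

/-- The composite of the monad `A ⊗ -` with its opposite monad. -/
abbrev envMonad : Monad C := (braidingBDLaw A).oppDistributiveLaw.compMonad

/-- The unit of the enveloping algebra, as a morphism into `A ⊗ A`. -/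
def envOne : 𝟙_ C ⟶ A ⊗ A := (MonObj.one : 𝟙_ C ⟶ Env A)

/-- The multiplication of the enveloping algebra, as a morphism into `A ⊗ A`. -/
def envMul : (A ⊗ A) ⊗ (A ⊗ A) ⟶ A ⊗ A := (MonObj.mul : Env A ⊗ Env A ⟶ Env A)

/-- The unit of the composite monad, as a morphism into `A ⊗ A ⊗ X`. -/
def envMonadUnit (X : C) : X ⟶ A ⊗ A ⊗ X := (envMonad A).η.app X

/-- The multiplication of the composite monad, as a morphism into `A ⊗ A ⊗ X`. -/
def envMonadMul (X : C) : A ⊗ A ⊗ A ⊗ A ⊗ X ⟶ A ⊗ A ⊗ X := (envMonad A).μ.app X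

lemma envOne_whiskerRight (X : C) :
    envOne A ▷ X ≫ (α_ A A X).hom = (λ_ X).hom ≫ envMonadUnit A X := by
  change ((λ_ (𝟙_ C)).inv ≫ ((MonObj.one : 𝟙_ C ⟶ A) ⊗ₘ (MonObj.one : 𝟙_ C ⟶ A))) ▷ X ≫
      (α_ A A X).hom =
    (λ_ X).hom ≫ ((λ_ X).inv ≫ (MonObj.one : 𝟙_ C ⟶ A) ▷ X) ≫ (λ_ (A ⊗ X)).inv ≫
      (MonObj.one : 𝟙_ C ⟶ A) ▷ (A ⊗ X)
  rw [tensorHom_def']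
  monoidal

/-- Up to associators, both multiplications are `(m ⊗ m · τ) · (A ⊗ τ ⊗ A)`, so only coherence is
involved. -/
lemma envMul_whiskerRight (X : C) :
    envMul A ▷ X ≫ (α_ A A X).hom =
      (α_ (A ⊗ A) (A ⊗ A) X).hom ≫ (α_ A A ((A ⊗ A) ⊗ X)).hom ≫
        A ◁ A ◁ (α_ A A X).hom ≫ envMonadMul A X := by
  change (((α_ A A (A ⊗ A)).hom ≫ A ◁ (α_ A A A).inv ≫ A ◁ (β_ A A).hom ▷ A ≫
      A ◁ (α_ A A A).hom ≫ (α_ A A (A ⊗ A)).inv) ≫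
        ((MonObj.mul : A ⊗ A ⟶ A) ⊗ₘ ((β_ A A).hom ≫ (MonObj.mul : A ⊗ A ⟶ A)))) ▷ X ≫
      (α_ A A X).hom = (α_ (A ⊗ A) (A ⊗ A) X).hom ≫ (α_ A A ((A ⊗ A) ⊗ X)).hom ≫
        A ◁ A ◁ (α_ A A X).hom ≫ A ◁ tau A (A ⊗ X) ≫
          A ◁ A ◁ (tau A X ≫ (α_ A A X).inv ≫ (MonObj.mul : A ⊗ A ⟶ A) ▷ X) ≫
            (α_ A A (A ⊗ X)).inv ≫ (MonObj.mul : A ⊗ A ⟶ A) ▷ (A ⊗ X)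
  rw [tensorHom_def', tau, tau]
  monoidal

variable {A}

lemma envOne_smul_iff {X : C} (h : (A ⊗ A) ⊗ X ⟶ X) (a : A ⊗ A ⊗ X ⟶ X)
    (ha : (α_ A A X).hom ≫ a = h) :
    envOne A ▷ X ≫ h = (λ_ X).hom ↔ envMonadUnit A X ≫ a = 𝟙 X := by
  rw [← ha, reassoc_of% envOne_whiskerRight A X]
  exact ⟨fun h => by simpa using (λ_ X).inv ≫= h, fun h => by rw [h, Category.comp_id]⟩

lemma envMul_smul_iff {X : C} (h : (A ⊗ A) ⊗ X ⟶ X) (a : A ⊗ A ⊗ X ⟶ X)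
    (ha : (α_ A A X).hom ≫ a = h) :
    envMul A ▷ X ≫ h = (α_ (A ⊗ A) (A ⊗ A) X).hom ≫ (A ⊗ A) ◁ h ≫ h ↔
      envMonadMul A X ≫ a = A ◁ A ◁ a ≫ a := by
  rw [← ha, reassoc_of% envMul_whiskerRight A X, cancel_epi]
  simp only [tensor_whiskerLeft, Category.assoc, Iso.inv_hom_id_assoc, whiskerLeft_comp,
    cancel_epi]

/-- The module over the enveloping algebra underlying an algebra over the composite monad. -/
def algebraToMod (N : (envMonad A).Algebra) : Mod C (Env A) where
  X := N.A
  mod :=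
    { smul := (α_ A A N.A).hom ≫ N.a
      one_smul := (envOne_smul_iff _ N.a rfl).2 N.unit
      mul_smul := (envMul_smul_iff _ N.a rfl).2 N.assoc }

/-- The algebra over the composite monad underlying a module over the enveloping algebra. -/
def modToAlgebra (M : Mod C (Env A)) : (envMonad A).Algebra where
  A := M.X
  a := ((α_ A A M.X).inv ≫ envAct A M : A ⊗ A ⊗ M.X ⟶ M.X)
  unit := (envOne_smul_iff (envAct A M) _ (Iso.hom_inv_id_assoc _ _)).1
    (ModObj.one_smul_self (Env A) M.X)
  assoc := (envMul_smul_iff (envAct A M) _ (Iso.hom_inv_id_assoc _ _)).1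
    (ModObj.mul_smul_self (Env A) M.X)

/-- Every module thus comes from an algebra over the composite monad, which lets condition 2 be
tested on such algebras. -/
lemma algebraToMod_modToAlgebra (M : Mod C (Env A)) :
    algebraToMod (modToAlgebra M) = M := by
  have h : (algebraToMod (modToAlgebra M)).mod = M.mod :=
    ModObj.ext _ _ (Iso.hom_inv_id_assoc _ _)
  -- The carriers agree definitionally, so only the action varies and no transport is needed.
  exact congrArg (fun _ : ModObj (Env A) M.X => (⟨M.X⟩ : Mod C (Env A))) h

lemma firstAct_algebraToMod (N : (envMonad A).Algebra) :
    firstAct A (algebraToMod N) = (braidingBDLaw A).leftAct N :=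
  leftAct_eq_of_comp _ N.a rfl

lemma secondAct_algebraToMod (N : (envMonad A).Algebra) :
    secondAct A (algebraToMod N) = (braidingBDLaw A).rightAct N :=
  rightAct_eq_of_comp _ N.a rfl

/-! ### The adjunction between comparison and invariants -/

variable [MonoidalClosed C] [HasEqualizers C]

/-- The invariants of an algebra over the composite monad represent the morphisms on which the two
underlying actions agree. -/
noncomputable def invariantsEquiv (N : (envMonad A).Algebra) (X : C) :
    {g : X ⟶ N.A // A ◁ g ≫ (braidingBDLaw A).rightAct N = A ◁ g ≫ (braidingBDLaw A).leftAct N} ≃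
      (X ⟶ invariants A (algebraToMod N)) where
  toFun g := equalizer.lift g.1 ((comp_coev_map_eq_iff _ _ _).2 (by
    rw [firstAct_algebraToMod, secondAct_algebraToMod]; exact g.2))
  invFun f := ⟨f ≫ invariantsInclusion A (algebraToMod N), by
    rw [← firstAct_algebraToMod, ← secondAct_algebraToMod]
    exact (comp_coev_map_eq_iff _ _ _).1 (((Category.assoc _ _ _).trans
      (congrArg (f ≫ ·) (equalizer.condition _ _))).trans (Category.assoc _ _ _).symm)⟩
  left_inv g := Subtype.ext (equalizer.lift_ι _ _)
  right_inv f := equalizer.hom_ext (equalizer.lift_ι _ _)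

/-- Morphisms out of a value of the comparison functor correspond to morphisms into the
invariants. -/
noncomputable def comparisonHomEquivInvariants (X : C) (N : (envMonad A).Algebra) :
    ((braidingBDLaw A).comparison.obj X ⟶ N) ≃ (X ⟶ invariants A (algebraToMod N)) :=
  ((braidingBDLaw A).comparisonHomEquiv N X).trans (invariantsEquiv N X)

lemma comparisonHomEquivInvariants_comp_inclusion {X : C} {N : (envMonad A).Algebra}
    (f : (braidingBDLaw A).comparison.obj X ⟶ N) :
    comparisonHomEquivInvariants X N f ≫ invariantsInclusion A (algebraToMod N) =
      ((λ_ X).inv ≫ (MonObj.one : 𝟙_ C ⟶ A) ▷ X) ≫ f.f :=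
  equalizer.lift_ι _ _

instance (M : Mod C (Env A)) : IsRegularMono (invariantsInclusion A M) :=
  inferInstanceAs (IsRegularMono (equalizer.ι _ _))

/-- The inclusion of invariants is monic, so the claim reduces to naturality of the unit of `A ⊗ -`.
-/
lemma comparisonHomEquivInvariants_naturality {X X' : C} {N : (envMonad A).Algebra}
    (f : X' ⟶ X) (g : (braidingBDLaw A).comparison.obj X ⟶ N) :
    comparisonHomEquivInvariants X' N ((braidingBDLaw A).comparison.map f ≫ g) =
      f ≫ comparisonHomEquivInvariants X N g := by
  have : Mono (invariantsInclusion A (algebraToMod N)) := inferInstance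
  rw [← cancel_mono (invariantsInclusion A (algebraToMod N)), Category.assoc,
    comparisonHomEquivInvariants_comp_inclusion, comparisonHomEquivInvariants_comp_inclusion]
  change ((λ_ X').inv ≫ (MonObj.one : 𝟙_ C ⟶ A) ▷ X') ≫ A ◁ f ≫ g.f = _
  have h := (leftMonad A).η.naturality f
  change f ≫ (λ_ X).inv ≫ (MonObj.one : 𝟙_ C ⟶ A) ▷ X =
    ((λ_ X').inv ≫ (MonObj.one : 𝟙_ C ⟶ A) ▷ X') ≫ A ◁ f at h
  refine (Category.assoc _ _ _).symm.trans ((congrArg (· ≫ g.f) h.symm).trans ?_)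
  exact Category.assoc _ _ _

variable (A)

/-- The comparison functor of the monad `A ⊗ -` is left adjoint to taking invariants. -/
noncomputable def comparisonAdjunction : (braidingBDLaw A).comparison ⊣
    Adjunction.rightAdjointOfEquiv comparisonHomEquivInvariants
      (fun _ _ _ => comparisonHomEquivInvariants_naturality) :=
  Adjunction.adjunctionOfEquivRight _ _

lemma comparisonAdjunction_unit_app (X : C) :
    (comparisonAdjunction A).unit.app X = comparisonHomEquivInvariants X _ (𝟙 _) := by
  simp [comparisonAdjunction]

lemma comparisonAdjunction_counit_app_f (N : (envMonad A).Algebra) :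
    ((comparisonAdjunction A).counit.app N).f = invariantsMap A (algebraToMod N) := by
  have h : (comparisonAdjunction A).counit.app N =
      (comparisonHomEquivInvariants _ N).symm (𝟙 _) := by
    simp [comparisonAdjunction]
  rw [h, invariantsMap, firstAct_algebraToMod]
  exact congrArg (fun f => A ◁ f ≫ (braidingBDLaw A).leftAct N) (Category.id_comp _)

lemma comparisonAdjunction_unit_app_comp_inclusion (X : C) :
    (comparisonAdjunction A).unit.app X ≫
        invariantsInclusion A (algebraToMod ((braidingBDLaw A).comparison.obj X)) =
      (λ_ X).inv ≫ (MonObj.one : 𝟙_ C ⟶ A) ▷ X := by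
  rw [comparisonAdjunction_unit_app]
  refine (comparisonHomEquivInvariants_comp_inclusion _).trans ?_
  exact Category.comp_id _

/-- The forgetful functor of an Eilenberg–Moore category preserves and reflects isomorphisms. -/
lemma isIso_comparisonAdjunction_counit_app_iff (N : (envMonad A).Algebra) :
    IsIso ((comparisonAdjunction A).counit.app N) ↔
      IsIso (invariantsMap A (algebraToMod N)) := by
  rw [← comparisonAdjunction_counit_app_f]
  exact (isIso_iff_of_reflects_iso ((comparisonAdjunction A).counit.app N)
    (envMonad A).forget).symm

variable {A}

/-- Up to a unitor, `e ⊗ Z` is the invertible adjunction unit followed by the inclusion of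
invariants. -/
lemma isPureMono_one_of_isLeftAzumaya (hA : IsLeftAzumaya A) :
    IsPureMono (MonObj.one : 𝟙_ C ⟶ A) := by
  intro Z
  have : (braidingBDLaw A).comparison.IsEquivalence := hA
  have h := comparisonAdjunction_unit_app_comp_inclusion A Z
  refine (MorphismProperty.cancel_left_of_respectsIso (MorphismProperty.regularMono C)
    (λ_ Z).inv _).1 ?_
  rw [← h]
  exact (MorphismProperty.cancel_left_of_respectsIso (MorphismProperty.regularMono C) _ _).2
    (inferInstanceAs (IsRegularMono (invariantsInclusion A _)))

end Monoidal

end AzumayaTheory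

theorem mainTheorem12 {C : Type u} [Category.{v} C] [MonoidalCategory C] [BraidedCategory C]
    [MonoidalClosed C] [HasEqualizers C] (A : C) [MonObj A] :
    AzumayaTheory.IsLeftAzumaya A ↔
      AzumayaTheory.IsPureMono (MonObj.one : 𝟙_ C ⟶ A) ∧
        ∀ M : Mod C (AzumayaTheory.Env A), IsIso (AzumayaTheory.invariantsMap A M) := by
  refine ⟨fun hA => ⟨AzumayaTheory.isPureMono_one_of_isLeftAzumaya hA, fun M => ?_⟩, fun h => ?_⟩
  · have : (AzumayaTheory.braidingBDLaw A).comparison.IsEquivalence := hA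
    rw [← AzumayaTheory.algebraToMod_modToAlgebra M,
      ← AzumayaTheory.isIso_comparisonAdjunction_counit_app_iff]
    infer_instance
  · have hc (N : (AzumayaTheory.envMonad A).Algebra) :
        IsIso ((AzumayaTheory.comparisonAdjunction A).counit.app N) :=
      (AzumayaTheory.isIso_comparisonAdjunction_counit_app_iff A N).2 (h.2 _)
    have hu (X : C) : IsIso ((AzumayaTheory.comparisonAdjunction A).unit.app X) := by
      have h1 := (AzumayaTheory.comparisonAdjunction A).left_triangle_components X
      -- The triangle identity exhibits this morphism as a section of an invertible counit
      -- component.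
      have h2 : IsIso ((AzumayaTheory.braidingBDLaw A).comparison.map
          ((AzumayaTheory.comparisonAdjunction A).unit.app X)) := by
        have h3 := hc ((AzumayaTheory.braidingBDLaw A).comparison.obj X)
        exact (isIso_comp_right_iff _ ((AzumayaTheory.comparisonAdjunction A).counit.app _)).1
          (by rw [h1]; exact IsIso.id _)
      -- Forgetting the module structure after comparison is the functor `A ⊗ -`.
      have h3 : IsIso (A ◁ (AzumayaTheory.comparisonAdjunction A).unit.app X) :=
        inferInstanceAs (IsIso ((AzumayaTheory.envMonad A).forget.map
          ((AzumayaTheory.braidingBDLaw A).comparison.map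
            ((AzumayaTheory.comparisonAdjunction A).unit.app X))))
      exact AzumayaTheory.isIso_of_isIso_whiskerLeft h.1 _
    exact (AzumayaTheory.comparisonAdjunction A).toEquivalence.isEquivalence_functor
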